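/- Let $D \subset \mathbb{C}^n$ be a convex domain (a nonempty, connected, open set that is convex), not necessarily bounded. For $z,w\in D$ let $$k_D(z,w)=\inf\sum_{i=0}^{m}\rho(a_i,b_i)$$ be the Kobayashi pseudodistance, where $\rho(a,b)=\log\frac{1+t}{1-t}$ with $t=\left|\frac{a-b}{1-\bar a b}\right|$ is the Poincaré distance of the unit disc $\Delta$, and the infimum is over all $m\ge 0$, all holomorphic maps $f_0,\dots,f_m:\Delta\to D$ and all points $a_i,b_i\in\Delta$ with $f_0(a_0)=z$, $f_i(b_i)=f_{i+1}(a_{i+1})$ for $0\le i<m$, and $f_m(b_m)=w$. Suppose that $D$ is Kobayashi hyperbolic, i.e. $k_D(z,w)=0$ implies $z=w$ for all $z,w\in D$. Then for every $z\in D$ and every $r>0$ the Kobayashi ball $$B(z,r)=\{w\in D : k_D(z,w)<r\}$$ is a bounded convex domain in $\mathbb{C}^n$. -/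

import Mathlib

open Set Metric
open scoped ENNReal

noncomputable section

/-- The Poincaré distance of the unit disc in `ℂ`, normalized to have curvature `-1`, that is,
the distance of the metric `4 |dζ|² / (1 - |ζ|²)²`. It is meant for points of the unit disc. -/
def poincareDist (a b : ℂ) : ℝ :=
  Real.log ((1 + ‖(a - b) / (1 - (starRingEnd ℂ) a * b)‖) /
    (1 - ‖(a - b) / (1 - (starRingEnd ℂ) a * b)‖))

variable {E : Type*} [NormedAddCommGroup E] [NormedSpace ℂ E]

/-- A chain of `m + 1` holomorphic discs in `D` joining `z` to `w`: holomorphic maps `f i` from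
the open unit disc into `D`, with points `a i`, `b i` of the disc such that `f 0 (a 0) = z`,
`f i (b i) = f (i + 1) (a (i + 1))` and `f m (b m) = w`. -/
structure IsDiscChain (D : Set E) (z w : E) {m : ℕ} (f : Fin (m + 1) → ℂ → E)
    (a b : Fin (m + 1) → ℂ) : Prop where
  holo : ∀ i, DifferentiableOn ℂ (f i) (ball 0 1)
  mapsTo : ∀ i, MapsTo (f i) (ball 0 1) D
  left_mem : ∀ i, a i ∈ ball (0 : ℂ) 1
  right_mem : ∀ i, b i ∈ ball (0 : ℂ) 1
  start : f 0 (a 0) = z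
  link : ∀ i : Fin m, f i.castSucc (b i.castSucc) = f i.succ (a i.succ)
  finish : f (Fin.last m) (b (Fin.last m)) = w

/-- The Kobayashi (pseudo)distance of `D`: the infimum of the total Poincaré lengths of the chains
of holomorphic discs in `D` joining `z` to `w`. The value is `∞` if there is no such chain, which
does not happen for two points of a domain. -/
def kobayashiDist (D : Set E) (z w : E) : ℝ≥0∞ :=
  ⨅ (m : ℕ) (f : Fin (m + 1) → ℂ → E) (a : Fin (m + 1) → ℂ) (b : Fin (m + 1) → ℂ)
    (_ : IsDiscChain D z w f a b), ENNReal.ofReal (∑ i, poincareDist (a i) (b i))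

/-- `D` is (Kobayashi) hyperbolic: its Kobayashi pseudodistance is a distance. -/
def IsKobayashiHyperbolic (D : Set E) : Prop :=
  ∀ z ∈ D, ∀ w ∈ D, kobayashiDist D z w = 0 → z = w

/-- The open Kobayashi ball of `D` with center `z` and radius `r`. -/
def kobayashiBall (D : Set E) (z : E) (r : ℝ) : Set E :=
  {w | w ∈ D ∧ kobayashiDist D z w < ENNReal.ofReal r}

/-- A domain: a nonempty connected open set. -/
def IsDomainSet (D : Set E) : Prop :=
  IsOpen D ∧ IsConnected D

end

/-!
A disc joining `p` to `q` at Poincaré length `l` can be normalized by an automorphism of the unit disc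
so that `p` and `q` are the values at `0` and at `tanh (l / 2)` (`DiscStep`). Such a step can be
lengthened (`DiscStep.mono`), cut at a point of the geodesic between the two parameters
(`DiscStep.split`), and, in a convex set, averaged with another step of the same length
(`DiscStep.convex_comb`).

Convexity. Let `w` and `w'` be joined to `z` by chains of total length less than `ρ < r`. For large
`N` both chains can be cut into exactly `N` steps of length `ρ / N` (`IsDiscChain.mem_discReach`), and
averaging them step by step gives a chain of length `ρ` from `z` to any convex combination of `w` and
`w'`. This avoids Lempert's theorem that one disc suffices in a convex domain. Connectedness follows
from convexity, and openness holds because short affine discs in every direction extend the chains.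

Boundedness. A hyperbolic set contains no complex line, so by the Hahn-Banach theorem the complex
functionals `φ` whose real part is bounded above on `D` have trivial common kernel, and they span the
dual space. If `re φ < c` on `D`, then Schwarz's lemma for the half-plane shows that a step of length
`l` multiplies `|c - φ|` by at most `exp l` (`DiscStep.norm_sub_le`), so `φ` is bounded on the ball.
Hence all functionals are bounded there, in particular the coordinates.
-/

/-! ### The Poincaré distance -/

theorem tanh_half_eq (l : ℝ) :
    Real.tanh (l / 2) = (Real.exp l - 1) / (Real.exp l + 1) := by
  have h : Real.exp l = Real.exp (l / 2) * Real.exp (l / 2) := by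
    rw [← Real.exp_add]; ring_nf
  have h1 := Real.exp_pos (l / 2)
  rw [Real.tanh_eq, Real.exp_neg, h]
  field_simp

theorem tanh_le_tanh {x y : ℝ} (h : x ≤ y) : Real.tanh x ≤ Real.tanh y := by
  rw [← Real.artanh_le_artanh_iff ⟨Real.neg_one_lt_tanh x, Real.tanh_lt_one x⟩
    ⟨Real.neg_one_lt_tanh y, Real.tanh_lt_one y⟩, Real.artanh_tanh, Real.artanh_tanh]
  exact h

theorem tanh_nonneg {x : ℝ} (h : 0 ≤ x) : 0 ≤ Real.tanh x := by
  simpa using tanh_le_tanh h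

theorem tanh_pos {x : ℝ} (h : 0 < x) : 0 < Real.tanh x := by
  refine (tanh_nonneg h.le).lt_of_ne' fun h0 => h.ne' ?_
  exact Real.tanh_injective (by simpa using h0)

theorem ofReal_tanh_mem_ball (x : ℝ) : (Real.tanh x : ℂ) ∈ ball (0 : ℂ) 1 := by
  rw [mem_ball_zero_iff, Complex.norm_real]
  exact Real.abs_tanh_lt_one x

/-- The map `x ↦ tanh (x / 2)` is the unit-speed parametrization of the diameter `(-1, 1)`. -/
theorem poincareDist_tanh {x y : ℝ} (h : x ≤ y) :
    poincareDist (Real.tanh (x / 2) : ℝ) (Real.tanh (y / 2) : ℝ) = y - x := by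
  have hx := Real.exp_pos x
  have hy := Real.exp_pos y
  have key : ((Real.tanh (x / 2) : ℝ) - Real.tanh (y / 2)) /
      (1 - Real.tanh (x / 2) * Real.tanh (y / 2)) =
      (Real.exp x - Real.exp y) / (Real.exp x + Real.exp y) := by
    have h1 : (1 - Real.tanh (x / 2) * Real.tanh (y / 2)) ≠ 0 := by
      have := Real.abs_tanh_lt_one (x / 2)
      have := Real.abs_tanh_lt_one (y / 2)
      have h3 : |Real.tanh (x / 2) * Real.tanh (y / 2)| < 1 := by
        rw [abs_mul]
        nlinarith [abs_nonneg (Real.tanh (x / 2)), abs_nonneg (Real.tanh (y / 2))]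
      have := (abs_lt.1 h3).2
      linarith
    rw [div_eq_div_iff h1 (by positivity), tanh_half_eq, tanh_half_eq]
    field_simp
    ring
  have hnorm : ‖((Real.tanh (x / 2) : ℝ) - (Real.tanh (y / 2) : ℝ) : ℂ) /
      (1 - (starRingEnd ℂ) (Real.tanh (x / 2) : ℝ) * (Real.tanh (y / 2) : ℝ))‖ =
      (Real.exp y - Real.exp x) / (Real.exp x + Real.exp y) := by
    rw [Complex.conj_ofReal]
    have : (((Real.tanh (x / 2) : ℝ) - (Real.tanh (y / 2) : ℝ) : ℂ) /
      (1 - ((Real.tanh (x / 2) : ℝ) : ℂ) * (Real.tanh (y / 2) : ℝ))) =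
      (((Real.tanh (x / 2) - Real.tanh (y / 2)) /
        (1 - Real.tanh (x / 2) * Real.tanh (y / 2)) : ℝ) : ℂ) := by push_cast; rfl
    rw [this, Complex.norm_real, key, Real.norm_eq_abs, abs_div,
      abs_of_pos (by positivity : 0 < Real.exp x + Real.exp y),
      abs_of_nonpos (by linarith [Real.exp_le_exp.2 h])]
    ring
  rw [poincareDist, hnorm]
  have : (1 + (Real.exp y - Real.exp x) / (Real.exp x + Real.exp y)) /
      (1 - (Real.exp y - Real.exp x) / (Real.exp x + Real.exp y)) = Real.exp (y - x) := by
    rw [Real.exp_sub]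
    have h2 : 1 - (Real.exp y - Real.exp x) / (Real.exp x + Real.exp y) =
      2 * Real.exp x / (Real.exp x + Real.exp y) := by field_simp; ring
    rw [h2]
    field_simp
    ring
  rw [this, Real.log_exp]

theorem one_sub_conj_mul_ne_zero {a b : ℂ} (ha : a ∈ ball (0 : ℂ) 1) (hb : b ∈ ball (0 : ℂ) 1) :
    1 - (starRingEnd ℂ) a * b ≠ 0 := by
  rw [mem_ball_zero_iff] at ha hb
  intro h
  have h1 : ‖(starRingEnd ℂ) a * b‖ = 1 := by rw [← sub_eq_zero.1 h, norm_one]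
  rw [norm_mul, RCLike.norm_conj] at h1
  nlinarith [norm_nonneg a, norm_nonneg b]

/-- The pseudo-hyperbolic distance of two points of the disc is less than `1`. -/
theorem norm_sub_div_lt_one {a b : ℂ} (ha : a ∈ ball (0 : ℂ) 1) (hb : b ∈ ball (0 : ℂ) 1) :
    ‖(a - b) / (1 - (starRingEnd ℂ) a * b)‖ < 1 := by
  have hne := one_sub_conj_mul_ne_zero ha hb
  rw [mem_ball_zero_iff] at ha hb
  rw [norm_div, div_lt_one (norm_pos_iff.2 hne)]
  refine lt_of_pow_lt_pow_left₀ 2 (norm_nonneg _) ?_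
  have ha2 : ‖a‖ ^ 2 < 1 := by nlinarith [norm_nonneg a]
  have hb2 : ‖b‖ ^ 2 < 1 := by nlinarith [norm_nonneg b]
  have key : ‖1 - (starRingEnd ℂ) a * b‖ ^ 2 - ‖a - b‖ ^ 2 = (1 - ‖a‖ ^ 2) * (1 - ‖b‖ ^ 2) := by
    simp only [← Complex.normSq_eq_norm_sq, Complex.normSq_apply, Complex.sub_re, Complex.sub_im,
      Complex.mul_re, Complex.mul_im, Complex.conj_re, Complex.conj_im, Complex.one_re,
      Complex.one_im]
    ring
  nlinarith

theorem poincareDist_eq_two_mul_artanh {a b : ℂ} (ha : a ∈ ball (0 : ℂ) 1)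
    (hb : b ∈ ball (0 : ℂ) 1) :
    poincareDist a b = 2 * Real.artanh ‖(a - b) / (1 - (starRingEnd ℂ) a * b)‖ := by
  have h := norm_sub_div_lt_one ha hb
  have h0 := norm_nonneg ((a - b) / (1 - (starRingEnd ℂ) a * b))
  rw [poincareDist, Real.artanh_eq_half_log ⟨by linarith, h.le⟩]
  ring

theorem tanh_poincareDist_half {a b : ℂ} (ha : a ∈ ball (0 : ℂ) 1) (hb : b ∈ ball (0 : ℂ) 1) :
    Real.tanh (poincareDist a b / 2) = ‖(a - b) / (1 - (starRingEnd ℂ) a * b)‖ := by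
  rw [poincareDist_eq_two_mul_artanh ha hb, mul_div_cancel_left₀ _ two_ne_zero,
    Real.tanh_artanh ⟨by linarith [norm_nonneg ((a - b) / (1 - (starRingEnd ℂ) a * b))],
      norm_sub_div_lt_one ha hb⟩]

theorem poincareDist_nonneg {a b : ℂ} (ha : a ∈ ball (0 : ℂ) 1) (hb : b ∈ ball (0 : ℂ) 1) :
    0 ≤ poincareDist a b := by
  rw [poincareDist_eq_two_mul_artanh ha hb]
  have := Real.artanh_nonneg (norm_nonneg ((a - b) / (1 - (starRingEnd ℂ) a * b)))
  positivity

/-- The automorphism group of the disc is transitive on pairs of points at a given distance: some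
holomorphic self-map of the disc takes `0` to `a` and the point of `[0, 1)` at distance
`poincareDist a b` from `0` to `b`. -/
theorem exists_moebius {a b : ℂ} (ha : a ∈ ball (0 : ℂ) 1) (hb : b ∈ ball (0 : ℂ) 1) :
    ∃ φ : ℂ → ℂ, DifferentiableOn ℂ φ (ball 0 1) ∧ MapsTo φ (ball 0 1) (ball 0 1) ∧
      φ 0 = a ∧ φ (Real.tanh (poincareDist a b / 2) : ℝ) = b := by
  set c : ℂ := (b - a) / (1 - (starRingEnd ℂ) a * b) with hc
  have hne := one_sub_conj_mul_ne_zero ha hb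
  have hct : (Real.tanh (poincareDist a b / 2)) = ‖c‖ := by
    rw [tanh_poincareDist_half ha hb, hc, norm_div, norm_div, norm_sub_rev]
  have hna : -a ∈ ball (0 : ℂ) 1 := by simpa using ha
  -- the rotation that takes `‖c‖` to `c`
  set u : ℂ := Complex.exp (c.arg * Complex.I) with hu
  have hu1 : ‖u‖ = 1 := Complex.norm_exp_ofReal_mul_I _
  have huc : u * ‖c‖ = c := by rw [mul_comm]; exact Complex.norm_mul_exp_arg_mul_I c
  have hub : ∀ ζ ∈ ball (0 : ℂ) 1, u * ζ ∈ ball (0 : ℂ) 1 := fun ζ hζ => by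
    simpa [hu1] using hζ
  have hden : ∀ ζ ∈ ball (0 : ℂ) 1, 1 + (starRingEnd ℂ) a * (u * ζ) ≠ 0 := fun ζ hζ => by
    simpa using one_sub_conj_mul_ne_zero hna (hub ζ hζ)
  refine ⟨fun ζ => (u * ζ + a) / (1 + (starRingEnd ℂ) a * (u * ζ)), ?_, ?_, by simp, ?_⟩
  · exact DifferentiableOn.div (by fun_prop) (by fun_prop) hden
  · intro ζ hζ
    have := norm_sub_div_lt_one hna (hub ζ hζ)
    rw [mem_ball_zero_iff]
    convert this using 1
    rw [norm_div, norm_div, ← norm_neg (-a - u * ζ)]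
    congr 2
    · ring
    · simp
  · rw [hct]
    simp only [huc]
    have hca : 1 + (starRingEnd ℂ) a * c ≠ 0 := by
      have hcb : c ∈ ball (0 : ℂ) 1 := by
        rw [mem_ball_zero_iff, ← hct]; exact Real.tanh_lt_one _
      simpa using one_sub_conj_mul_ne_zero hna hcb
    have hcm : c * (1 - (starRingEnd ℂ) a * b) = b - a := div_mul_cancel₀ _ hne
    rw [div_eq_iff hca]
    linear_combination hcm

/-! ### Steps along holomorphic discs -/

section Steps

variable {E : Type*} [NormedAddCommGroup E] [NormedSpace ℂ E] {D : Set E} {p q : E} {l l' : ℝ}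

/-- `DiscStep D l p q`: some holomorphic disc in `D` takes `0` to `p` and `tanh (l / 2)`, the point
of `[0, 1)` at Poincaré distance `l` from `0`, to `q`. It is meant for `0 ≤ l`. -/
def DiscStep (D : Set E) (l : ℝ) (p q : E) : Prop :=
  ∃ f : ℂ → E, DifferentiableOn ℂ f (ball 0 1) ∧ MapsTo f (ball 0 1) D ∧ f 0 = p ∧
    f (Real.tanh (l / 2) : ℝ) = q

theorem DiscStep.right_mem (h : DiscStep D l p q) : q ∈ D := by
  obtain ⟨f, -, hm, -, rfl⟩ := h
  exact hm (ofReal_tanh_mem_ball _)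

theorem DiscStep.eq_of_length_zero (h : DiscStep D 0 p q) : p = q := by
  obtain ⟨f, -, -, rfl, rfl⟩ := h
  simp

theorem DiscStep.of_disc {f : ℂ → E} (hf : DifferentiableOn ℂ f (ball 0 1))
    (hm : MapsTo f (ball 0 1) D) {a b : ℂ} (ha : a ∈ ball (0 : ℂ) 1) (hb : b ∈ ball (0 : ℂ) 1) :
    DiscStep D (poincareDist a b) (f a) (f b) := by
  obtain ⟨φ, hφ, hφm, h0, h1⟩ := exists_moebius ha hb
  exact ⟨f ∘ φ, hf.comp hφ hφm, hm.comp hφm, congrArg f h0, congrArg f h1⟩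

/-- Lengths of steps can be increased: precompose the disc with a contraction `ζ ↦ c * ζ`. -/
theorem DiscStep.mono (h : DiscStep D l p q) (hl : 0 ≤ l) (hll' : l ≤ l') : DiscStep D l' p q := by
  obtain ⟨f, hf, hm, rfl, rfl⟩ := h
  have h0 : 0 ≤ Real.tanh (l / 2) := tanh_nonneg (by linarith)
  have h1 : Real.tanh (l / 2) ≤ Real.tanh (l' / 2) := tanh_le_tanh (by linarith)
  set s := Real.tanh (l / 2)
  set t := Real.tanh (l' / 2)
  have hst : ‖((s / t : ℝ) : ℂ)‖ ≤ 1 := by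
    rw [Complex.norm_real, Real.norm_eq_abs, abs_of_nonneg (div_nonneg h0 (h0.trans h1))]
    exact div_le_one_of_le₀ h1 (h0.trans h1)
  have hb : MapsTo (fun ζ : ℂ => ((s / t : ℝ) : ℂ) * ζ) (ball 0 1) (ball 0 1) := fun ζ hζ => by
    rw [mem_ball_zero_iff] at hζ ⊢
    rw [norm_mul]
    nlinarith [norm_nonneg ζ, norm_nonneg ((s / t : ℝ) : ℂ)]
  refine ⟨fun ζ => f (((s / t : ℝ) : ℂ) * ζ), hf.comp (by fun_prop) hb, hm.comp hb, by simp, ?_⟩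
  have : s / t * t = s := by
    rcases eq_or_ne t 0 with ht | ht
    · rw [ht, mul_zero]; linarith
    · field_simp
  change f (((s / t : ℝ) : ℂ) * (t : ℝ)) = f (s : ℝ)
  rw [← Complex.ofReal_mul, this]

/-- A step can be cut at any intermediate point of the geodesic from `0` to `tanh ((l + l') / 2)`. -/
theorem DiscStep.split (h : DiscStep D (l + l') p q) (hl' : 0 ≤ l') :
    ∃ x, DiscStep D l p x ∧ DiscStep D l' x q := by
  obtain ⟨f, hf, hm, rfl, rfl⟩ := h
  refine ⟨f (Real.tanh (l / 2) : ℝ), ⟨f, hf, hm, rfl, rfl⟩, ?_⟩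
  have := DiscStep.of_disc hf hm (ofReal_tanh_mem_ball (l / 2)) (ofReal_tanh_mem_ball ((l + l') / 2))
  rwa [poincareDist_tanh (by linarith), add_sub_cancel_left] at this

/-- Steps of the same length in a convex set can be averaged, because their discs use the same two
points `0` and `tanh (l / 2)`. -/
theorem DiscStep.convex_comb [NormedSpace ℝ E] [IsScalarTower ℝ ℂ E] (hD : Convex ℝ D)
    {p' q' : E} (h : DiscStep D l p q) (h' : DiscStep D l p' q') {s t : ℝ} (hs : 0 ≤ s)
    (ht : 0 ≤ t) (hst : s + t = 1) :
    DiscStep D l (s • p + t • p') (s • q + t • q') := by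
  obtain ⟨f, hf, hm, rfl, rfl⟩ := h
  obtain ⟨g, hg, hm', rfl, rfl⟩ := h'
  exact ⟨fun ζ => s • f ζ + t • g ζ, (hf.const_smul s).add (hg.const_smul t),
    fun ζ hζ => hD (hm hζ) (hm' hζ) hs ht hst, rfl, rfl⟩

/-- A step along the affine disc centred at `p` that takes `tanh (l / 2)` to `p + v`. -/
theorem DiscStep.of_affine (v : E) (hl : 0 < l)
    (h : ∀ ζ : ℂ, ‖ζ‖ < (Real.tanh (l / 2))⁻¹ → p + ζ • v ∈ D) : DiscStep D l p (p + v) := by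
  have ht : 0 < Real.tanh (l / 2) := tanh_pos (by linarith)
  refine ⟨fun ζ => p + (ζ * ((Real.tanh (l / 2))⁻¹ : ℝ)) • v, by fun_prop, fun ζ hζ => h _ ?_,
    by simp, ?_⟩
  · rw [mem_ball_zero_iff] at hζ
    rw [norm_mul, Complex.norm_real, Real.norm_eq_abs, abs_of_pos (inv_pos.2 ht)]
    exact mul_lt_of_lt_one_left (inv_pos.2 ht) hζ
  · simp only [← Complex.ofReal_mul, mul_inv_cancel₀ ht.ne', Complex.ofReal_one, one_smul]

theorem DiscStep.refl (hp : p ∈ D) : DiscStep D l p p :=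
  ⟨fun _ => p, differentiableOn_const p, fun _ _ => hp, rfl, rfl⟩

/-! ### Schwarz's lemma for half-planes -/

theorem norm_sub_le_norm_add_conj {u v : ℂ} (hu : 0 ≤ u.re) (hv : 0 ≤ v.re) :
    ‖u - v‖ ≤ ‖u + (starRingEnd ℂ) v‖ := by
  refine le_of_sq_le_sq ?_ (norm_nonneg _)
  simp only [← Complex.normSq_eq_norm_sq, Complex.normSq_apply, Complex.sub_re, Complex.sub_im,
    Complex.add_re, Complex.add_im, Complex.conj_re, Complex.conj_im]
  nlinarith [mul_nonneg hu hv]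

/-- Schwarz's lemma for a map `g` into the right half-plane, applied to its Cayley transform
`(g - g 0) / (g + conj (g 0))`. The exponential bound is weaker than the Schwarz-Pick inequality but
multiplicative along chains. -/
theorem norm_le_exp_mul_norm_of_re_pos {g : ℂ → ℂ} (hg : DifferentiableOn ℂ g (ball 0 1))
    (hpos : ∀ ζ ∈ ball (0 : ℂ) 1, 0 < (g ζ).re) (hl : 0 ≤ l) :
    ‖g (Real.tanh (l / 2) : ℝ)‖ ≤ Real.exp l * ‖g 0‖ := by
  have h0 := hpos 0 (by simp)
  have hne : ∀ ζ ∈ ball (0 : ℂ) 1, g ζ + (starRingEnd ℂ) (g 0) ≠ 0 := fun ζ hζ h => by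
    have := congrArg Complex.re h
    simp at this
    linarith [hpos ζ hζ]
  have hb := ofReal_tanh_mem_ball (l / 2)
  have ht0 : 0 ≤ Real.tanh (l / 2) := tanh_nonneg (by linarith)
  have hS := Complex.norm_le_norm_of_mapsTo_ball (R := 1)
    (f := fun ζ => (g ζ - g 0) / (g ζ + (starRingEnd ℂ) (g 0)))
    (DifferentiableOn.div (hg.sub_const _) (hg.add_const _) hne)
    (fun ζ hζ => by
      rw [mem_closedBall_zero_iff, norm_div]
      exact div_le_one_of_le₀ (norm_sub_le_norm_add_conj (hpos ζ hζ).le h0.le) (norm_nonneg _))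
    (by simp) (mem_ball_zero_iff.1 hb)
  rw [norm_div, div_le_iff₀ (norm_pos_iff.2 (hne _ hb)), Complex.norm_real, Real.norm_eq_abs,
    abs_of_nonneg ht0] at hS
  have h1 := norm_sub_norm_le (g (Real.tanh (l / 2) : ℝ)) (g 0)
  have h2 := norm_add_le (g (Real.tanh (l / 2) : ℝ)) ((starRingEnd ℂ) (g 0))
  rw [RCLike.norm_conj] at h2
  set t := Real.tanh (l / 2)
  have h3 : ‖g (t : ℝ)‖ - ‖g 0‖ ≤ t * (‖g (t : ℝ)‖ + ‖g 0‖) :=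
    h1.trans (hS.trans (mul_le_mul_of_nonneg_left h2 ht0))
  have he := Real.exp_pos l
  have h4 : t * (Real.exp l + 1) = Real.exp l - 1 := by
    have : t = (Real.exp l - 1) / (Real.exp l + 1) := tanh_half_eq l
    rw [this]
    field_simp
  -- multiply `h3` by `exp l + 1`
  have h5 := mul_le_mul_of_nonneg_left h3 (by positivity : 0 ≤ Real.exp l + 1)
  rw [← mul_assoc, mul_comm (Real.exp l + 1) t, h4] at h5
  nlinarith

/-- If `D` lies in the half-space `re φ < c`, a step of length `l` increases the distance of `φ`
to `c` at most by the factor `exp l`. -/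
theorem DiscStep.norm_sub_le (h : DiscStep D l p q) (hl : 0 ≤ l) {φ : E →L[ℂ] ℂ} {c : ℝ}
    (hc : ∀ x ∈ D, (φ x).re < c) : ‖c - φ q‖ ≤ Real.exp l * ‖c - φ p‖ := by
  obtain ⟨f, hf, hm, rfl, rfl⟩ := h
  refine norm_le_exp_mul_norm_of_re_pos (g := fun ζ => c - φ (f ζ)) ?_ ?_ hl
  · exact (φ.differentiable.comp_differentiableOn hf).const_sub _
  · intro ζ hζ
    simpa using hc _ (hm hζ)

end Steps

/-! ### Chains of discs and the Kobayashi distance -/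

section Chains

variable {E : Type*} [NormedAddCommGroup E] [NormedSpace ℂ E] {D : Set E} {z w p q : E}

theorem IsDiscChain.init {m : ℕ} {f : Fin (m + 2) → ℂ → E} {a b : Fin (m + 2) → ℂ}
    (h : IsDiscChain D z w f a b) :
    IsDiscChain D z (f (Fin.last (m + 1)) (a (Fin.last (m + 1))))
      (fun i : Fin (m + 1) => f i.castSucc) (fun i => a i.castSucc) (fun i => b i.castSucc) where
  holo _ := h.holo _
  mapsTo _ := h.mapsTo _
  left_mem _ := h.left_mem _
  right_mem _ := h.right_mem _
  start := h.start
  link i := h.link i.castSucc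
  finish := h.link (Fin.last m)

theorem IsDiscChain.snoc {m : ℕ} {f : Fin (m + 1) → ℂ → E} {a b : Fin (m + 1) → ℂ}
    (h : IsDiscChain D z w f a b) {g : ℂ → E} (hg : DifferentiableOn ℂ g (ball 0 1))
    (hm : MapsTo g (ball 0 1) D) {c d : ℂ} (hc : c ∈ ball (0 : ℂ) 1) (hd : d ∈ ball (0 : ℂ) 1)
    (hgw : g c = w) :
    IsDiscChain D z (g d) (Fin.snoc (α := fun _ => ℂ → E) f g) (Fin.snoc (α := fun _ => ℂ) a c)
      (Fin.snoc (α := fun _ => ℂ) b d) where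
  holo i := by
    refine Fin.lastCases ?_ (fun j => ?_) i
    · simpa using hg
    · simpa using h.holo j
  mapsTo i := by
    refine Fin.lastCases ?_ (fun j => ?_) i
    · simpa using hm
    · simpa using h.mapsTo j
  left_mem i := by
    refine Fin.lastCases ?_ (fun j => ?_) i
    · simpa using hc
    · simpa using h.left_mem j
  right_mem i := by
    refine Fin.lastCases ?_ (fun j => ?_) i
    · simpa using hd
    · simpa using h.right_mem j
  start := by
    rw [← Fin.castSucc_zero, Fin.snoc_castSucc, Fin.snoc_castSucc]
    exact h.start
  link i := by
    refine Fin.lastCases ?_ (fun j => ?_) i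
    · rw [Fin.succ_last]
      simp only [Fin.snoc_castSucc, Fin.snoc_last]
      rw [h.finish, hgw]
    · rw [Fin.succ_castSucc]
      simp only [Fin.snoc_castSucc]
      exact h.link j
  finish := by simp

theorem kobayashiDist_self (hz : z ∈ D) : kobayashiDist D z z = 0 := by
  refine le_antisymm ?_ zero_le
  refine iInf_le_of_le 0 <| iInf_le_of_le (fun _ _ => z) <| iInf_le_of_le (fun _ => 0) <|
    iInf_le_of_le (fun _ => 0) <| iInf_le_of_le ?_ ?_
  · exact ⟨fun _ => differentiableOn_const z, fun _ _ _ => hz, by simp, by simp, rfl,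
      fun _ => rfl, rfl⟩
  · simp [poincareDist]

theorem kobayashiDist_le_add (z : E) {l : ℝ} (hl : 0 ≤ l) (h : DiscStep D l p q) :
    kobayashiDist D z q ≤ kobayashiDist D z p + ENNReal.ofReal l := by
  obtain ⟨g, hg, hm, hp, rfl⟩ := h
  conv_rhs => simp only [kobayashiDist, ENNReal.iInf_add]
  refine le_iInf fun m => le_iInf fun f => le_iInf fun a => le_iInf fun b => le_iInf fun hc => ?_
  have hchain := hc.snoc hg hm (c := (Real.tanh (0 / 2) : ℝ)) (ofReal_tanh_mem_ball _)
    (ofReal_tanh_mem_ball (l / 2)) (by simpa using hp)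
  refine iInf_le_of_le (m + 1) <| iInf_le_of_le _ <| iInf_le_of_le _ <| iInf_le_of_le _ <|
    iInf_le_of_le hchain ?_
  rw [Fin.sum_univ_castSucc]
  simp only [Fin.snoc_castSucc, Fin.snoc_last]
  rw [poincareDist_tanh hl, sub_zero]
  exact ENNReal.ofReal_add_le

theorem kobayashiDist_lt_iff {c : ℝ≥0∞} : kobayashiDist D z w < c ↔
    ∃ (m : ℕ) (f : Fin (m + 1) → ℂ → E) (a b : Fin (m + 1) → ℂ),
      IsDiscChain D z w f a b ∧ ENNReal.ofReal (∑ i, poincareDist (a i) (b i)) < c := by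
  simp only [kobayashiDist, iInf_lt_iff, exists_prop]

/-- The points that can be reached from `z` by `k` successive steps of length `ε`. -/
def discReach (D : Set E) (ε : ℝ) (z : E) : ℕ → Set E
  | 0 => {z}
  | k + 1 => {q | ∃ p ∈ discReach D ε z k, DiscStep D ε p q}

theorem kobayashiDist_le_of_mem_discReach {ε : ℝ} (hε : 0 ≤ ε) (hz : z ∈ D) :
    ∀ {k : ℕ} {w : E}, w ∈ discReach D ε z k → kobayashiDist D z w ≤ ENNReal.ofReal (k * ε)
  | 0, w, h => by
    rw [discReach, mem_singleton_iff] at h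
    rw [h, kobayashiDist_self hz]
    exact zero_le
  | k + 1, w, ⟨p, hp, hpw⟩ => by
    refine (kobayashiDist_le_add z hε hpw).trans ?_
    rw [Nat.cast_add_one, add_one_mul, ENNReal.ofReal_add (by positivity) hε]
    exact add_le_add_left (kobayashiDist_le_of_mem_discReach hε hz hp) _

theorem mem_discReach_add {ε : ℝ} (hε : 0 ≤ ε) {j : ℕ} (hp : p ∈ discReach D ε z j) :
    ∀ (k : ℕ) {q : E}, DiscStep D (k * ε) p q → q ∈ discReach D ε z (j + k)
  | 0, q, h => by
    rw [Nat.cast_zero, zero_mul] at h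
    rwa [← h.eq_of_length_zero]
  | k + 1, q, h => by
    rw [Nat.cast_add_one, add_one_mul] at h
    obtain ⟨x, hx, hxq⟩ := h.split hε
    exact ⟨x, mem_discReach_add hε hp k hx, hxq⟩

/-- A chain of `m + 1` discs of total length `L` can be cut into steps of length `ε`. Rounding up
the length of each disc to a multiple of `ε` costs at most `ε` for each disc. -/
theorem IsDiscChain.mem_discReach {ε : ℝ} (hε : 0 < ε) {m : ℕ} :
    ∀ {w : E} {f : Fin (m + 1) → ℂ → E} {a b : Fin (m + 1) → ℂ}, IsDiscChain D z w f a b →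
      ∀ {k : ℕ}, ∑ i, poincareDist (a i) (b i) + (m + 1) * ε ≤ k * ε → w ∈ discReach D ε z k := by
  induction m with
  | zero =>
    intro w f a b h k hk
    have hs := DiscStep.of_disc (h.holo 0) (h.mapsTo 0) (h.left_mem 0) (h.right_mem 0)
    have hfw : f 0 (b 0) = w := h.finish
    rw [h.start, hfw] at hs
    rw [← Nat.zero_add k]
    refine mem_discReach_add hε.le (mem_singleton z) k
      (hs.mono (poincareDist_nonneg (h.left_mem 0) (h.right_mem 0)) ?_)
    simp at hk
    linarith
  | succ m ih =>
    intro w f a b h k hk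
    set i := Fin.last (m + 1)
    have hs := DiscStep.of_disc (h.holo i) (h.mapsTo i) (h.left_mem i) (h.right_mem i)
    have h0 := poincareDist_nonneg (h.left_mem i) (h.right_mem i)
    set l := poincareDist (a i) (b i)
    rw [h.finish] at hs
    rw [Fin.sum_univ_castSucc] at hk
    change _ + l + _ ≤ _ at hk
    set S := ∑ i : Fin (m + 1), poincareDist (a i.castSucc) (b i.castSucc)
    have hS : 0 ≤ S := Finset.sum_nonneg fun j _ => poincareDist_nonneg (h.left_mem _) (h.right_mem _)
    push_cast at hk
    -- the last disc is cut into `j` steps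
    set j := ⌈l / ε⌉₊
    have hj : l ≤ j * ε := (div_le_iff₀ hε).1 (Nat.le_ceil _)
    have hj' : j * ε < l + ε := by
      have := mul_lt_mul_of_pos_right (Nat.ceil_lt_add_one (div_nonneg h0 hε.le)) hε
      rwa [add_mul, div_mul_cancel₀ _ hε.ne', one_mul] at this
    have hjk : j ≤ k := by
      have hm : 0 ≤ (m : ℝ) * ε := by positivity
      have : (j : ℝ) * ε < k * ε := by linarith
      exact_mod_cast (lt_of_mul_lt_mul_right this hε.le).le
    have := ih h.init (k := k - j) (by rw [Nat.cast_sub hjk]; linarith)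
    have := mem_discReach_add hε.le this j (hs.mono h0 hj)
    rwa [Nat.sub_add_cancel hjk] at this

theorem convex_discReach [NormedSpace ℝ E] [IsScalarTower ℝ ℂ E] (hD : Convex ℝ D) (ε : ℝ)
    (z : E) : ∀ k, Convex ℝ (discReach D ε z k)
  | 0 => convex_singleton z
  | k + 1 => by
    rintro q ⟨p, hp, hpq⟩ q' ⟨p', hp', hpq'⟩ s t hs ht hst
    exact ⟨_, convex_discReach hD ε z k hp hp' hs ht hst, hpq.convex_comb hD hpq' hs ht hst⟩

/-! ### Kobayashi balls -/

theorem isOpen_kobayashiBall (hD : IsOpen D) (z : E) (r : ℝ) : IsOpen (kobayashiBall D z r) := by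
  rw [Metric.isOpen_iff]
  rintro w ⟨hw, hwr⟩
  obtain ⟨δ, hδ, hball⟩ := Metric.isOpen_iff.1 hD w hw
  obtain ⟨c, hc, hcr⟩ := ENNReal.lt_iff_exists_add_pos_lt.1 hwr
  set l : ℝ := (c : ℝ)
  have hl : 0 < l := hc
  have ht : 0 < Real.tanh (l / 2) := tanh_pos (by linarith)
  refine ⟨δ * Real.tanh (l / 2), by positivity, fun w' hw' => ?_⟩
  have hv : ‖w' - w‖ < δ * Real.tanh (l / 2) := by rwa [mem_ball_iff_norm] at hw'
  have hstep : DiscStep D l w (w + (w' - w)) := DiscStep.of_affine _ hl fun ζ hζ => hball <| by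
    rw [mem_ball_iff_norm, add_sub_cancel_left, norm_smul]
    calc ‖ζ‖ * ‖w' - w‖ ≤ (Real.tanh (l / 2))⁻¹ * ‖w' - w‖ := by gcongr
      _ < (Real.tanh (l / 2))⁻¹ * (δ * Real.tanh (l / 2)) := by gcongr
      _ = δ := by field_simp
  rw [add_sub_cancel] at hstep
  refine ⟨hstep.right_mem, (kobayashiDist_le_add z hl.le hstep).trans_lt ?_⟩
  simpa [l] using hcr

theorem mem_kobayashiBall_self {r : ℝ} (hr : 0 < r) (hz : z ∈ D) : z ∈ kobayashiBall D z r :=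
  ⟨hz, by rw [kobayashiDist_self hz]; exact ENNReal.ofReal_pos.2 hr⟩

/-- Kobayashi balls of convex sets are convex: two points of the ball are reached from `z` by the
same number of steps of the same length, hence so are their convex combinations. -/
theorem convex_kobayashiBall [NormedSpace ℝ E] [IsScalarTower ℝ ℂ E] (hD : Convex ℝ D) {r : ℝ}
    (hr : 0 < r) (hz : z ∈ D) : Convex ℝ (kobayashiBall D z r) := by
  rintro w ⟨hw, hwr⟩ w' ⟨hw', hwr'⟩ s t hs ht hst
  obtain ⟨m, f, a, b, hc, hlt⟩ := kobayashiDist_lt_iff.1 hwr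
  obtain ⟨m', f', a', b', hc', hlt'⟩ := kobayashiDist_lt_iff.1 hwr'
  rw [ENNReal.ofReal_lt_ofReal_iff hr] at hlt hlt'
  obtain ⟨ρ, hρ, hρr⟩ := exists_between (max_lt hr (max_lt hlt hlt'))
  simp only [max_lt_iff] at hρ
  obtain ⟨hρ0, hρ1, hρ2⟩ := hρ
  -- steps of length `ρ / N` for large `N`, so that the rounding error is below `ρ` minus the chain length
  obtain ⟨N, hN⟩ := exists_nat_gt (max ((m + 1) * ρ / (ρ - ∑ i, poincareDist (a i) (b i)))
    ((m' + 1) * ρ / (ρ - ∑ i, poincareDist (a' i) (b' i))))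
  simp only [max_lt_iff] at hN
  obtain ⟨hN1, hN2⟩ := hN
  have hNpos : 0 < (N : ℝ) := lt_of_le_of_lt
    (div_nonneg (by positivity) (sub_nonneg.2 hρ1.le)) hN1
  have hfit : ∀ {S M : ℝ}, S < ρ → M * ρ / (ρ - S) < N → S + M * (ρ / N) ≤ N * (ρ / N) := by
    intro S M hS hM
    rw [div_lt_iff₀ (sub_pos.2 hS)] at hM
    have h1 : M * (ρ / N) < ρ - S := by
      rw [← mul_div_assoc, div_lt_iff₀ hNpos]
      linarith
    rw [mul_div_cancel₀ _ hNpos.ne']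
    linarith
  have hε : 0 < ρ / N := by positivity
  have hmem := convex_discReach hD (ρ / N) z N (hc.mem_discReach hε (hfit hρ1 hN1))
    (hc'.mem_discReach hε (hfit hρ2 hN2)) hs ht hst
  refine ⟨hD hw hw' hs ht hst, (kobayashiDist_le_of_mem_discReach hε.le hz hmem).trans_lt ?_⟩
  rw [mul_div_cancel₀ _ hNpos.ne', ENNReal.ofReal_lt_ofReal_iff hr]
  exact hρr

/-! ### Boundedness -/

theorem IsDiscChain.norm_sub_le {φ : E →L[ℂ] ℂ} {c : ℝ} (hφ : ∀ x ∈ D, (φ x).re < c) {m : ℕ} :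
    ∀ {w : E} {f : Fin (m + 1) → ℂ → E} {a b : Fin (m + 1) → ℂ}, IsDiscChain D z w f a b →
      ‖c - φ w‖ ≤ Real.exp (∑ i, poincareDist (a i) (b i)) * ‖c - φ z‖ := by
  induction m with
  | zero =>
    intro w f a b h
    have := (DiscStep.of_disc (h.holo 0) (h.mapsTo 0) (h.left_mem 0) (h.right_mem 0)).norm_sub_le
      (poincareDist_nonneg (h.left_mem 0) (h.right_mem 0)) hφ
    have hfw : f 0 (b 0) = w := h.finish
    rw [h.start, hfw] at this
    simpa using this
  | succ m ih =>
    intro w f a b h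
    set i := Fin.last (m + 1)
    have := (DiscStep.of_disc (h.holo i) (h.mapsTo i) (h.left_mem i) (h.right_mem i)).norm_sub_le
      (poincareDist_nonneg (h.left_mem i) (h.right_mem i)) hφ
    rw [h.finish] at this
    rw [Fin.sum_univ_castSucc, add_comm, Real.exp_add, mul_assoc]
    exact this.trans (mul_le_mul_of_nonneg_left (ih h.init) (Real.exp_pos _).le)

/-- A functional whose real part is bounded above on `D` is bounded on the Kobayashi balls. -/
theorem norm_le_of_mem_kobayashiBall {φ : E →L[ℂ] ℂ} {c : ℝ} (hφ : ∀ x ∈ D, (φ x).re < c) {r : ℝ}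
    (hr : 0 < r) (hw : w ∈ kobayashiBall D z r) : ‖φ w‖ ≤ ‖(c : ℂ)‖ + Real.exp r * ‖c - φ z‖ := by
  obtain ⟨m, f, a, b, hc, hlt⟩ := kobayashiDist_lt_iff.1 hw.2
  rw [ENNReal.ofReal_lt_ofReal_iff hr] at hlt
  calc ‖φ w‖ = ‖c - (c - φ w)‖ := by rw [sub_sub_cancel]
    _ ≤ ‖(c : ℂ)‖ + ‖c - φ w‖ := _root_.norm_sub_le _ _
    _ ≤ ‖(c : ℂ)‖ + Real.exp r * ‖c - φ z‖ := by
      gcongr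
      refine (hc.norm_sub_le hφ).trans ?_
      gcongr

/-- A hyperbolic set contains no complex line. -/
theorem IsKobayashiHyperbolic.eq_zero_of_line_subset (h : IsKobayashiHyperbolic D) {v : E}
    (hp : ∀ ζ : ℂ, p + ζ • v ∈ D) : v = 0 := by
  have hpD : p ∈ D := by simpa using hp 0
  have hqD : p + v ∈ D := by simpa using hp 1
  have h0 : kobayashiDist D p (p + v) = 0 := by
    refine le_antisymm (ENNReal.le_of_forall_pos_le_add fun ε hε _ => ?_) zero_le
    have := kobayashiDist_le_add p (NNReal.coe_pos.2 hε).le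
      (DiscStep.of_affine v (NNReal.coe_pos.2 hε) fun ζ _ => hp ζ)
    rwa [kobayashiDist_self hpD, ENNReal.ofReal_coe_nnreal] at this
  simpa using h p hpD _ hqD h0

/-- On a hyperbolic convex open set, the functionals with real part bounded above on the set
separate points: a vector killed by all of them would be the direction of a complex line in `D`, by
the Hahn-Banach theorem. -/
theorem IsKobayashiHyperbolic.eq_zero_of_forall_functional [NormedSpace ℝ E] [IsScalarTower ℝ ℂ E]
    (h : IsKobayashiHyperbolic D) (hD : IsOpen D) (hconv : Convex ℝ D) (hp : p ∈ D) {v : E}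
    (hv : ∀ (φ : E →L[ℂ] ℂ) (c : ℝ), (∀ x ∈ D, (φ x).re < c) → φ v = 0) : v = 0 := by
  refine h.eq_zero_of_line_subset (p := p) fun ζ => ?_
  by_contra hζ
  obtain ⟨φ, hφ⟩ := RCLike.geometric_hahn_banach_open_point (𝕜 := ℂ) hconv hD hζ
  have := hφ p hp
  rw [map_add, map_smul, hv φ _ hφ, smul_zero, add_zero] at this
  exact lt_irrefl _ this

/-- The functionals bounded on the ball form a subspace of the dual space. Its common kernel is
trivial, so in finite dimension it contains the coordinates. -/
theorem isBounded_kobayashiBall [NormedSpace ℝ E] [IsScalarTower ℝ ℂ E] [FiniteDimensional ℂ E]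
    (h : IsKobayashiHyperbolic D) (hD : IsOpen D) (hconv : Convex ℝ D) (hz : z ∈ D) {r : ℝ}
    (hr : 0 < r) : Bornology.IsBounded (kobayashiBall D z r) := by
  -- the functionals that are bounded on the ball
  let W : Submodule ℂ (Module.Dual ℂ E) :=
    { carrier := {φ | ∃ C, ∀ w ∈ kobayashiBall D z r, ‖φ w‖ ≤ C}
      zero_mem' := ⟨0, by simp⟩
      add_mem' := by
        rintro φ ψ ⟨C, hC⟩ ⟨C', hC'⟩
        exact ⟨C + C', fun w hw => (norm_add_le _ _).trans (add_le_add (hC w hw) (hC' w hw))⟩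
      smul_mem' := by
        rintro c φ ⟨C, hC⟩
        refine ⟨‖c‖ * C, fun w hw => ?_⟩
        rw [LinearMap.smul_apply, norm_smul]
        exact mul_le_mul_of_nonneg_left (hC w hw) (norm_nonneg c) }
  have hW : W.dualCoannihilator = ⊥ := by
    refine (Submodule.eq_bot_iff _).2 fun v hv => ?_
    rw [Submodule.mem_dualCoannihilator] at hv
    exact h.eq_zero_of_forall_functional hD hconv hz fun φ c hφ =>
      hv φ.toLinearMap ⟨_, fun w hw => norm_le_of_mem_kobayashiBall hφ hr hw⟩
  have hWtop : W = ⊤ := by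
    rw [← Subspace.dualCoannihilator_dualAnnihilator_eq (W := W), hW,
      Submodule.dualAnnihilator_bot]
  let e := (Module.finBasis ℂ E).equivFunL
  have hb : Bornology.IsBounded (e '' kobayashiBall D z r) := by
    rw [← Bornology.forall_isBounded_image_eval_iff]
    intro i
    obtain ⟨C, hC⟩ : (Module.finBasis ℂ E).coord i ∈ W := hWtop ▸ Submodule.mem_top
    refine isBounded_iff_forall_norm_le.2 ⟨C, ?_⟩
    rintro _ ⟨_, ⟨w, hw, rfl⟩, rfl⟩
    exact hC w hw
  have := e.symm.lipschitz.isBounded_image hb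
  rwa [← image_comp, ContinuousLinearEquiv.symm_comp_self, image_id] at this

end Chains

theorem lemma5p1 (n : ℕ) (D : Set (EuclideanSpace ℂ (Fin n)))
    (hD : IsDomainSet D) (hconv : Convex ℝ D) (hhyp : IsKobayashiHyperbolic D)
    (z : EuclideanSpace ℂ (Fin n)) (hz : z ∈ D) (r : ℝ) (hr : 0 < r) :
    IsDomainSet (kobayashiBall D z r) ∧ Convex ℝ (kobayashiBall D z r) ∧
      Bornology.IsBounded (kobayashiBall D z r) := by
  have hc := convex_kobayashiBall hconv hr hz
  exact ⟨⟨isOpen_kobayashiBall hD.1 z r, ⟨z, mem_kobayashiBall_self hr hz⟩, hc.isPreconnected⟩, hc,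
    isBounded_kobayashiBall hhyp hD.1 hconv hz hr⟩
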